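/- **Theorem.** Let $(\mathcal C,\otimes,\mathbb 1)$ be an abelian monoidal category that is rigid (every object has a left and a right dual). Let $A$ be a connected filtered algebra in $\mathcal C$ with finite monic filtration. Explicitly, $(A,m,u)$ is an associative unital algebra in $\mathcal C$ with a filtration, that is, a functor $F$ from the poset $\mathbb N_0=\{0,1,2,\dots\}$ to $\mathcal C$, with transition maps $\iota_i:F(i)\to F(i+1)$, together with canonical maps $\psi_i:F(i)\to A$ exhibiting $A$ as $\operatorname{colim}_i F(i)$. The filtration is multiplicative: there are a family of morphisms $m_{i,j}:F(i)\otimes F(j)\to F(i+j)$, natural in $i,j\in\mathbb N_0$, and a morphism $u_0:\mathbb 1\to F(0)$ which are associative and unital and satisfy $\psi_{i+j}\,m_{i,j}=m\,(\psi_i\otimes\psi_j)$ and $\psi_0\,u_0=u$ (equivalently, $A$ is an algebra in the monoidal category of $\mathbb N_0$-filtered objects of $\mathcal C$, where the tensor product has $F_{X\otimes Y}(k)=\operatorname{colim}_{i+j\le k}F_X(i)\otimes F_Y(j)$). Moreover: - (connected) $F(0)\cong\mathbb 1$; - (finite) there is an $n\in\mathbb N_0$ such that the transition map $F(n)\to F(i)$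 is an isomorphism for all $i\ge n$; - (monic) every $\iota_i$ is a monomorphism. Let $\operatorname{gr}(A)=\coprod_{i\in\mathbb N_0}\operatorname{gr}_i$ be the associated graded algebra, where $\operatorname{gr}_0=F(0)$ and $\operatorname{gr}_i=\operatorname{coker}(\iota_{i-1})$ for $i\ge1$; its multiplication has components $\operatorname{gr}_i\otimes\operatorname{gr}_j\to\operatorname{gr}_{i+j}$ induced by the $m_{i,j}$, and its unit is $\mathbb 1\xrightarrow{u_0}F(0)=\operatorname{gr}_0\to\operatorname{gr}(A)$. If $\operatorname{gr}(A)$ is a Frobenius algebra in $\mathcal C$, then $A$ is a Frobenius algebra in $\mathcal C$. Here an algebra $(B,m,u)$ in $\mathcal C$ is called Frobenius if there are morphisms $\Delta:B\to B\otimes B$ and $\varepsilon:B\to\mathbb 1$ making $B$ a coassociative counital coalgebra such that, up to the associativity isomorphisms, $$(m\otimes \mathrm{id}_B)(\mathrm{id}_B\otimes\Delta)=\Delta m=(\mathrm{id}_B\otimes m)(\Delta\otimes \mathrm{id}_B).$$ -/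

import Mathlib

open CategoryTheory CategoryTheory.Limits MonoidalCategory

universe v u

/-- An algebra `(A, m, u)` in a monoidal category is Frobenius if there is a coalgebra
structure `(Δ, ε)` on `A` with `(m ⊗ id)(id ⊗ Δ) = Δ m = (id ⊗ m)(Δ ⊗ id)`. -/
def IsFrobeniusAlgebra {C : Type u} [Category.{v} C] [MonoidalCategory C]
    (A : C) [MonObj A] : Prop :=
  ∃ _ : ComonObj A,
    A ◁ ComonObj.comul (X := A) ≫ (α_ A A A).inv ≫ MonObj.mul (X := A) ▷ A =
        MonObj.mul (X := A) ≫ ComonObj.comul (X := A) ∧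
    ComonObj.comul (X := A) ▷ A ≫ (α_ A A A).hom ≫ A ◁ MonObj.mul (X := A) =
        MonObj.mul (X := A) ≫ ComonObj.comul (X := A)

/-- An `ℕ`-filtration on an object `X`: a functor `F` from the poset `ℕ` to `C` together with an
identification of `X` with the colimit of `F`. -/
structure ObjFiltration {C : Type u} [Category.{v} C] (X : C) where
  /-- The filtration, as a functor. -/
  F : ℕ ⥤ C
  /-- The canonical maps `F i ⟶ X`. -/
  ψ : F ⟶ (Functor.const ℕ).obj X
  /-- These maps exhibit `X` as the colimit of `F`. -/
  isColimit : IsColimit (Cocone.mk X ψ)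

namespace ObjFiltration

variable {C : Type u} [Category.{v} C] {X : C}

/-- The transition map `F i ⟶ F j` for `i ≤ j`. -/
def t (φ : ObjFiltration X) {i j : ℕ} (h : i ≤ j) : φ.F.obj i ⟶ φ.F.obj j :=
  φ.F.map (homOfLE h)

lemma t_self (φ : ObjFiltration X) {i : ℕ} (h : i ≤ i) : φ.t h = 𝟙 _ := by
  simp [t]

@[simp]
lemma t_comp (φ : ObjFiltration X) {i j k : ℕ} (h : i ≤ j) (h' : j ≤ k) :
    φ.t h ≫ φ.t h' = φ.t (h.trans h') := by
  simp only [t, ← Functor.map_comp]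
  rfl

/-- A filtration is finite if it is stationary from some step on. -/
class IsFinite (φ : ObjFiltration X) : Prop where
  exists_stationary : ∃ n : ℕ, ∀ (i : ℕ) (h : n ≤ i), IsIso (φ.t h)

/-- A filtration is monic if each map `F i ⟶ F (i + 1)` is a monomorphism. -/
def IsMonic (φ : ObjFiltration X) : Prop :=
  ∀ i : ℕ, Mono (φ.t (Nat.le_succ i))

variable [Abelian C]

/-- The `i`-th component of the associated graded object: the cokernel of `F (i - 1) ⟶ F i`,
and `F 0` for `i = 0`. -/
noncomputable def grPiece (φ : ObjFiltration X) : ℕ → C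
  | 0 => φ.F.obj 0
  | i + 1 => cokernel (φ.t (Nat.le_succ i))

/-- The projection of `F i` onto the `i`-th component of the associated graded object. -/
noncomputable def π (φ : ObjFiltration X) : ∀ i : ℕ, φ.F.obj i ⟶ φ.grPiece i
  | 0 => 𝟙 (φ.F.obj 0)
  | i + 1 => cokernel.π (φ.t (Nat.le_succ i))

instance epi_π (φ : ObjFiltration X) : ∀ i : ℕ, Epi (φ.π i)
  | 0 => inferInstanceAs (Epi (𝟙 (φ.F.obj 0)))
  | i + 1 => inferInstanceAs (Epi (cokernel.π (φ.t (Nat.le_succ i))))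

lemma t_π (φ : ObjFiltration X) {k i : ℕ} (h : k < i) : φ.t h.le ≫ φ.π i = 0 := by
  cases i with
  | zero => omega
  | succ i =>
    rw [← φ.t_comp (Nat.lt_succ_iff.mp h) (Nat.le_succ i), Category.assoc]
    have : φ.t (Nat.le_succ i) ≫ φ.π (i + 1) = 0 := cokernel.condition _
    rw [this, comp_zero]

lemma exists_π_fac (φ : ObjFiltration X) {i : ℕ} {Z : C} (f : φ.F.obj i ⟶ Z)
    (hf : ∀ (k : ℕ) (h : k < i), φ.t h.le ≫ f = 0) : ∃ g : φ.grPiece i ⟶ Z, φ.π i ≫ g = f := by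
  cases i with
  | zero => exact ⟨f, Category.id_comp f⟩
  | succ i => exact ⟨cokernel.desc _ f (hf i (Nat.lt_succ_self i)), cokernel.π_desc _ _ _⟩

lemma exists_isZero_grPiece (φ : ObjFiltration X) [φ.IsFinite] :
    ∃ n : ℕ, ∀ i : ℕ, n < i → IsZero (φ.grPiece i) := by
  obtain ⟨n, hn⟩ := IsFinite.exists_stationary (φ := φ)
  refine ⟨n, fun i hi => ?_⟩
  cases i with
  | zero => omega
  | succ i =>
    have h : n ≤ i := Nat.lt_succ_iff.mp hi
    have := hn i h
    have := hn (i + 1) hi.le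
    have h1 : IsIso (φ.t h ≫ φ.t (Nat.le_succ i)) := by rw [t_comp]; infer_instance
    have : IsIso (φ.t (Nat.le_succ i)) := IsIso.of_isIso_comp_left (φ.t h) _
    exact isZero_cokernel_of_epi _

/-- The associated graded object of a finite filtration exists in `C`, as only finitely many of
its components are nonzero. -/
instance hasCoproduct_grPiece (φ : ObjFiltration X) [φ.IsFinite] : HasCoproduct φ.grPiece := by
  classical
  obtain ⟨n, hn⟩ := φ.exists_isZero_grPiece
  let c : Cofan φ.grPiece := Cofan.mk (∐ fun i : Fin (n + 1) => φ.grPiece i) (fun i =>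
    if h : i < n + 1 then Sigma.ι (fun i : Fin (n + 1) => φ.grPiece i) ⟨i, h⟩ else 0)
  refine HasColimit.mk ⟨c, Cofan.IsColimit.mk c
    (fun s => Sigma.desc fun i : Fin (n + 1) => s.inj i) ?_ ?_⟩
  · intro s i
    by_cases h : i < n + 1
    · simp [c, h]
    · exact (hn i (by omega)).eq_of_src _ _
  · intro s m hm
    refine Sigma.hom_ext (f := fun i : Fin (n + 1) => φ.grPiece i) _ _ fun i => ?_
    have := hm i
    have hi : (i : ℕ) ≤ n := Nat.lt_succ_iff.mp i.2
    simpa [c, hi] using this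

/-- The associated graded object: the coproduct of its components. -/
noncomputable def gr (φ : ObjFiltration X) [φ.IsFinite] : C := ∐ φ.grPiece

/-- The inclusion of the `i`-th component of the associated graded object. -/
noncomputable def grι (φ : ObjFiltration X) [φ.IsFinite] (i : ℕ) : φ.grPiece i ⟶ φ.gr :=
  Sigma.ι φ.grPiece i

lemma exists_gr_desc (φ : ObjFiltration X) [φ.IsFinite] {Z : C} (f : ∀ i, φ.grPiece i ⟶ Z) :
    ∃ g : φ.gr ⟶ Z, ∀ i, φ.grι i ≫ g = f i :=
  ⟨Sigma.desc f, fun i => Sigma.ι_desc f i⟩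

lemma t_π_grι (φ : ObjFiltration X) [φ.IsFinite] {a b : ℕ} (h : a ≤ b) (e : a = b) :
    φ.t h ≫ φ.π b ≫ φ.grι b = φ.π a ≫ φ.grι a := by
  subst e
  rw [t_self, Category.id_comp]

section

variable [MonoidalCategory C] [RigidCategory C] {A : C}

lemma zero_whisker (X : C) {Y Z : C} : (0 : Y ⟶ Z) ▷ X = 0 := by
  have : (tensorRight X).IsLeftAdjoint := (tensorRightAdjunction X Xᘁ).isLeftAdjoint
  exact (tensorRight X).map_zero Y Z

lemma whisker_zero (X : C) {Y Z : C} : X ◁ (0 : Y ⟶ Z) = 0 := by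
  have : (tensorLeft X).IsLeftAdjoint := (tensorLeftAdjunction (ᘁX) X).isLeftAdjoint
  exact (tensorLeft X).map_zero Y Z

instance epi_whiskerRight (X : C) {Y Z : C} (f : Y ⟶ Z) [Epi f] : Epi (f ▷ X) := by
  have : (tensorRight X).IsLeftAdjoint := (tensorRightAdjunction X Xᘁ).isLeftAdjoint
  exact (tensorRight X).map_epi f

instance epi_whiskerLeft (X : C) {Y Z : C} (f : Y ⟶ Z) [Epi f] : Epi (X ◁ f) := by
  have : (tensorLeft X).IsLeftAdjoint := (tensorLeftAdjunction (ᘁX) X).isLeftAdjoint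
  exact (tensorLeft X).map_epi f

lemma exists_π_whiskerRight_fac (φ : ObjFiltration A) {i : ℕ} {X Z : C}
    (f : φ.F.obj i ⊗ X ⟶ Z) (hf : ∀ (k : ℕ) (h : k < i), φ.t h.le ▷ X ≫ f = 0) :
    ∃ g : φ.grPiece i ⊗ X ⟶ Z, φ.π i ▷ X ≫ g = f := by
  let E (Y : C) := tensorRightHomEquiv Y X Xᘁ Z
  obtain ⟨g, hg⟩ := φ.exists_π_fac (E _ f) (fun k h => by
    apply (E _).symm.injective
    have h1 := tensorRightHomEquiv_symm_naturality (Y := X) (Y' := Xᘁ) (φ.t h.le) (E _ f)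
    have h2 := tensorRightHomEquiv_symm_naturality (Y := X) (Y' := Xᘁ)
      (0 : φ.F.obj k ⟶ φ.F.obj i) (E _ f)
    rw [zero_whisker, zero_comp, zero_comp] at h2
    rw [Equiv.symm_apply_apply] at h1
    exact h1.trans ((hf k h).trans h2.symm))
  refine ⟨(E _).symm g, ?_⟩
  have h1 := tensorRightHomEquiv_symm_naturality (Y := X) (Y' := Xᘁ) (φ.π i) g
  rw [hg, Equiv.symm_apply_apply] at h1
  exact h1.symm

lemma exists_π_whiskerLeft_fac (φ : ObjFiltration A) {i : ℕ} {X Z : C}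
    (f : X ⊗ φ.F.obj i ⟶ Z) (hf : ∀ (k : ℕ) (h : k < i), X ◁ φ.t h.le ≫ f = 0) :
    ∃ g : X ⊗ φ.grPiece i ⟶ Z, X ◁ φ.π i ≫ g = f := by
  let E (Y : C) := tensorLeftHomEquiv Y (ᘁX) X Z
  obtain ⟨g, hg⟩ := φ.exists_π_fac (E _ f) (fun k h => by
    apply (E _).symm.injective
    have h1 := tensorLeftHomEquiv_symm_naturality (Y := (ᘁX)) (Y' := X) (φ.t h.le) (E _ f)
    have h2 := tensorLeftHomEquiv_symm_naturality (Y := (ᘁX)) (Y' := X)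
      (0 : φ.F.obj k ⟶ φ.F.obj i) (E _ f)
    rw [whisker_zero, zero_comp, zero_comp] at h2
    rw [Equiv.symm_apply_apply] at h1
    exact h1.trans ((hf k h).trans h2.symm))
  refine ⟨(E _).symm g, ?_⟩
  have h1 := tensorLeftHomEquiv_symm_naturality (Y := (ᘁX)) (Y' := X) (φ.π i) g
  rw [hg, Equiv.symm_apply_apply] at h1
  exact h1.symm

lemma hom_ext_right (φ : ObjFiltration A) [φ.IsFinite] {X Z : C} {f g : φ.gr ⊗ X ⟶ Z}
    (h : ∀ i, (φ.π i ≫ φ.grι i) ▷ X ≫ f = (φ.π i ≫ φ.grι i) ▷ X ≫ g) : f = g := by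
  apply (tensorRightHomEquiv φ.gr X Xᘁ Z).injective
  refine Sigma.hom_ext (f := φ.grPiece) _ _ fun i => ?_
  apply (tensorRightHomEquiv (φ.grPiece i) X Xᘁ Z).symm.injective
  change (tensorRightHomEquiv _ X Xᘁ Z).symm (φ.grι i ≫ _) =
    (tensorRightHomEquiv _ X Xᘁ Z).symm (φ.grι i ≫ _)
  rw [tensorRightHomEquiv_symm_naturality, tensorRightHomEquiv_symm_naturality,
    Equiv.symm_apply_apply, Equiv.symm_apply_apply, ← cancel_epi (φ.π i ▷ X)]
  simpa using h i

lemma hom_ext_left (φ : ObjFiltration A) [φ.IsFinite] {X Z : C} {f g : X ⊗ φ.gr ⟶ Z}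
    (h : ∀ i, X ◁ (φ.π i ≫ φ.grι i) ≫ f = X ◁ (φ.π i ≫ φ.grι i) ≫ g) : f = g := by
  apply (tensorLeftHomEquiv φ.gr (ᘁX) X Z).injective
  refine Sigma.hom_ext (f := φ.grPiece) _ _ fun i => ?_
  apply (tensorLeftHomEquiv (φ.grPiece i) (ᘁX) X Z).symm.injective
  change (tensorLeftHomEquiv _ (ᘁX) X Z).symm (φ.grι i ≫ _) =
    (tensorLeftHomEquiv _ (ᘁX) X Z).symm (φ.grι i ≫ _)
  rw [tensorLeftHomEquiv_symm_naturality, tensorLeftHomEquiv_symm_naturality,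
    Equiv.symm_apply_apply, Equiv.symm_apply_apply, ← cancel_epi (X ◁ φ.π i)]
  simpa using h i

lemma exists_desc_right (φ : ObjFiltration A) [φ.IsFinite] {X Z : C}
    (f : ∀ i, φ.grPiece i ⊗ X ⟶ Z) : ∃ g : φ.gr ⊗ X ⟶ Z, ∀ i, φ.grι i ▷ X ≫ g = f i := by
  obtain ⟨g, hg⟩ := φ.exists_gr_desc fun i => tensorRightHomEquiv _ X Xᘁ Z (f i)
  refine ⟨(tensorRightHomEquiv φ.gr X Xᘁ Z).symm g, fun i => ?_⟩
  rw [← tensorRightHomEquiv_symm_naturality, hg, Equiv.symm_apply_apply]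

lemma exists_desc_left (φ : ObjFiltration A) [φ.IsFinite] {X Z : C}
    (f : ∀ i, X ⊗ φ.grPiece i ⟶ Z) : ∃ g : X ⊗ φ.gr ⟶ Z, ∀ i, X ◁ φ.grι i ≫ g = f i := by
  obtain ⟨g, hg⟩ := φ.exists_gr_desc fun i => tensorLeftHomEquiv _ (ᘁX) X Z (f i)
  refine ⟨(tensorLeftHomEquiv φ.gr (ᘁX) X Z).symm g, fun i => ?_⟩
  rw [← tensorLeftHomEquiv_symm_naturality, hg, Equiv.symm_apply_apply]

lemma hom_ext_three (φ : ObjFiltration A) [φ.IsFinite] {Z : C}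
    {f g : (φ.gr ⊗ φ.gr) ⊗ φ.gr ⟶ Z}
    (h : ∀ i j k, (((φ.π i ≫ φ.grι i) ⊗ₘ (φ.π j ≫ φ.grι j)) ⊗ₘ (φ.π k ≫ φ.grι k)) ≫ f =
      (((φ.π i ≫ φ.grι i) ⊗ₘ (φ.π j ≫ φ.grι j)) ⊗ₘ (φ.π k ≫ φ.grι k)) ≫ g) : f = g := by
  refine φ.hom_ext_left fun k => ?_
  apply (tensorRightHomEquiv (φ.gr ⊗ φ.gr) (φ.F.obj k) (φ.F.obj k)ᘁ Z).injective
  refine φ.hom_ext_left fun j => ?_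
  apply (tensorRightHomEquiv (φ.gr ⊗ φ.F.obj j) (φ.F.obj k) (φ.F.obj k)ᘁ Z).symm.injective
  rw [tensorRightHomEquiv_symm_naturality, tensorRightHomEquiv_symm_naturality,
    Equiv.symm_apply_apply, Equiv.symm_apply_apply, ← cancel_epi (α_ _ _ _).inv]
  refine φ.hom_ext_right fun i => ?_
  have h1 := h i j k
  rw [MonoidalCategory.tensorHom_def (_ ⊗ₘ _), MonoidalCategory.tensorHom_def (φ.π i ≫ _),
    comp_whiskerRight, Category.assoc, Category.assoc, Category.assoc, Category.assoc] at h1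
  rw [associator_inv_naturality_left_assoc, associator_inv_naturality_left_assoc, h1]

end

end ObjFiltration

/-- A filtered algebra structure on an algebra `A` (an algebra in the monoidal category of
filtered objects of `C`). The tensor product of filtered objects has
`F_{X ⊗ Y} k = colim_{i + j ≤ k} F_X i ⊗ F_Y j`, and the unit is constant at `𝟙_ C`; by the
universal property of these colimits, the multiplication is a natural family of maps
`F i ⊗ F j ⟶ F (i + j)`, and the unit is a map `𝟙_ C ⟶ F 0`. They are associative and unital, and
they induce the multiplication and the unit of `A` on colimits. -/
structure AlgFiltration {C : Type u} [Category.{v} C] [MonoidalCategory C] (A : C) [MonObj A]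
    extends ObjFiltration A where
  /-- The components of the multiplication. -/
  m (i j : ℕ) : F.obj i ⊗ F.obj j ⟶ F.obj (i + j)
  /-- The unit. -/
  e : 𝟙_ C ⟶ F.obj 0
  m_natural {i i' j j' : ℕ} (hi : i ≤ i') (hj : j ≤ j') :
    (toObjFiltration.t hi ⊗ₘ toObjFiltration.t hj) ≫ m i' j' =
      m i j ≫ toObjFiltration.t (Nat.add_le_add hi hj)
  m_assoc (i j k : ℕ) :
    m i j ▷ F.obj k ≫ m (i + j) k ≫ toObjFiltration.t (Nat.add_assoc i j k).le =
      (α_ (F.obj i) (F.obj j) (F.obj k)).hom ≫ F.obj i ◁ m j k ≫ m i (j + k)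
  e_m (i : ℕ) :
    e ▷ F.obj i ≫ m 0 i ≫ toObjFiltration.t (Nat.zero_add i).le = (λ_ (F.obj i)).hom
  m_e (i : ℕ) : F.obj i ◁ e ≫ m i 0 = (ρ_ (F.obj i)).hom
  m_ψ (i j : ℕ) : m i j ≫ ψ.app (i + j) = (ψ.app i ⊗ₘ ψ.app j) ≫ MonObj.mul (X := A)
  e_ψ : e ≫ ψ.app 0 = MonObj.one (X := A)

namespace AlgFiltration

section

variable {C : Type u} [Category.{v} C] [MonoidalCategory C] {A : C} [MonObj A]

/-- A filtered algebra is connected if its zeroth filtered piece is the unit object. -/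
def IsConnected (φ : AlgFiltration A) : Prop := Nonempty (φ.F.obj 0 ≅ 𝟙_ C)

end

section

variable {C : Type u} [Category.{v} C] [Abelian C] [MonoidalCategory C] {A : C} [MonObj A]

lemma t_m_π_left (φ : AlgFiltration A) {k i : ℕ} (j : ℕ) (h : k < i) :
    φ.t h.le ▷ φ.F.obj j ≫ φ.m i j ≫ φ.π (i + j) = 0 := by
  have h1 := φ.m_natural h.le (le_refl j)
  rw [φ.t_self, tensorHom_id] at h1
  rw [reassoc_of% h1, φ.t_π (Nat.add_lt_add_right h j), comp_zero]

lemma t_m_π_right (φ : AlgFiltration A) {k j : ℕ} (i : ℕ) (h : k < j) :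
    φ.F.obj i ◁ φ.t h.le ≫ φ.m i j ≫ φ.π (i + j) = 0 := by
  have h1 := φ.m_natural (le_refl i) h.le
  rw [φ.t_self, id_tensorHom] at h1
  rw [reassoc_of% h1, φ.t_π (Nat.add_lt_add_left h i), comp_zero]

end

variable {C : Type u} [Category.{v} C] [Abelian C] [MonoidalCategory C] [RigidCategory C]
  {A : C} [MonObj A]

lemma exists_grMul (φ : AlgFiltration A) (i j : ℕ) :
    ∃ g : φ.grPiece i ⊗ φ.grPiece j ⟶ φ.grPiece (i + j),
      (φ.π i ⊗ₘ φ.π j) ≫ g = φ.m i j ≫ φ.π (i + j) := by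
  obtain ⟨f, hf⟩ := ObjFiltration.exists_π_whiskerRight_fac φ.toObjFiltration
    (φ.m i j ≫ φ.π (i + j)) (fun k h => φ.t_m_π_left j h)
  obtain ⟨g, hg⟩ := ObjFiltration.exists_π_whiskerLeft_fac φ.toObjFiltration f (fun k h => by
    rw [← cancel_epi (φ.π i ▷ φ.F.obj k), ← whisker_exchange_assoc, hf, φ.t_m_π_right i h,
      comp_zero])
  exact ⟨g, by rw [MonoidalCategory.tensorHom_def, Category.assoc, hg, hf]⟩

/-- The component `gr_i ⊗ gr_j ⟶ gr_{i + j}` of the multiplication of the associated graded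
algebra: the unique map induced on cokernels by `F i ⊗ F j ⟶ F (i + j)`. -/
noncomputable def grMul (φ : AlgFiltration A) (i j : ℕ) :
    φ.grPiece i ⊗ φ.grPiece j ⟶ φ.grPiece (i + j) :=
  (φ.exists_grMul i j).choose

lemma π_grMul (φ : AlgFiltration A) (i j : ℕ) :
    (φ.π i ⊗ₘ φ.π j) ≫ φ.grMul i j = φ.m i j ≫ φ.π (i + j) :=
  (φ.exists_grMul i j).choose_spec

lemma exists_mul (φ : AlgFiltration A) [φ.IsFinite] :
    ∃ g : φ.gr ⊗ φ.gr ⟶ φ.gr, ∀ i j : ℕ,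
      (φ.grι i ⊗ₘ φ.grι j) ≫ g = φ.grMul i j ≫ φ.grι (i + j) := by
  choose f hf using fun i : ℕ => ObjFiltration.exists_desc_left φ.toObjFiltration
    (X := φ.grPiece i) (fun j => φ.grMul i j ≫ φ.grι (i + j))
  obtain ⟨g, hg⟩ := ObjFiltration.exists_desc_right φ.toObjFiltration f
  exact ⟨g, fun i j => by rw [MonoidalCategory.tensorHom_def', Category.assoc, hg, hf]⟩

/-- The multiplication of the associated graded algebra: the unique map with components
`grMul i j`. -/
noncomputable def mul (φ : AlgFiltration A) [φ.IsFinite] : φ.gr ⊗ φ.gr ⟶ φ.gr :=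
  φ.exists_mul.choose

lemma grι_mul (φ : AlgFiltration A) [φ.IsFinite] (i j : ℕ) :
    (φ.grι i ⊗ₘ φ.grι j) ≫ φ.mul = φ.grMul i j ≫ φ.grι (i + j) :=
  φ.exists_mul.choose_spec i j

/-- The unit of the associated graded algebra. -/
noncomputable def one (φ : AlgFiltration A) [φ.IsFinite] : 𝟙_ C ⟶ φ.gr :=
  φ.e ≫ φ.π 0 ≫ φ.grι 0

lemma π_grι_mul (φ : AlgFiltration A) [φ.IsFinite] (i j : ℕ) :
    ((φ.π i ≫ φ.grι i) ⊗ₘ (φ.π j ≫ φ.grι j)) ≫ φ.mul =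
      φ.m i j ≫ φ.π (i + j) ≫ φ.grι (i + j) := by
  rw [← tensorHom_comp_tensorHom, Category.assoc, grι_mul, ← Category.assoc, π_grMul,
    Category.assoc]

/-- The associated graded algebra of a filtered algebra. -/
noncomputable instance grMonObj (φ : AlgFiltration A) [φ.IsFinite] : MonObj φ.gr where
  one := φ.one
  mul := φ.mul
  one_mul := by
    refine ObjFiltration.hom_ext_left φ.toObjFiltration fun i => ?_
    have h := φ.π_grι_mul 0 i
    rw [MonoidalCategory.tensorHom_def', Category.assoc] at h
    rw [leftUnitor_naturality, ← φ.e_m i, Category.assoc, Category.assoc,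
      φ.t_π_grι (Nat.zero_add i).le (Nat.zero_add i), ← h, one, whisker_exchange_assoc,
      comp_whiskerRight, Category.assoc, whisker_exchange_assoc]
  mul_one := by
    refine ObjFiltration.hom_ext_right φ.toObjFiltration fun i => ?_
    have h := φ.π_grι_mul i 0
    rw [MonoidalCategory.tensorHom_def, Category.assoc] at h
    rw [rightUnitor_naturality, ← φ.m_e i, Category.assoc]
    erw [← h]
    rw [one, ← whisker_exchange_assoc, MonoidalCategory.whiskerLeft_comp, Category.assoc,
      ← whisker_exchange_assoc]
  mul_assoc := by
    refine ObjFiltration.hom_ext_three φ.toObjFiltration fun i j k => ?_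
    have h1 := φ.π_grι_mul (i + j) k
    have h2 := φ.π_grι_mul i (j + k)
    rw [associator_naturality_assoc, ← tensorHom_id, ← id_tensorHom,
      tensorHom_comp_tensorHom_assoc, tensorHom_comp_tensorHom_assoc, π_grι_mul, π_grι_mul,
      Category.comp_id, Category.comp_id]
    have e1 : ((φ.m i j ≫ φ.π (i + j) ≫ φ.grι (i + j)) ⊗ₘ (φ.π k ≫ φ.grι k)) =
        φ.m i j ▷ _ ≫ ((φ.π (i + j) ≫ φ.grι (i + j)) ⊗ₘ (φ.π k ≫ φ.grι k)) := by
      rw [← tensorHom_id, tensorHom_comp_tensorHom, Category.id_comp]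
    have e2 : ((φ.π i ≫ φ.grι i) ⊗ₘ (φ.m j k ≫ φ.π (j + k) ≫ φ.grι (j + k))) =
        _ ◁ φ.m j k ≫ ((φ.π i ≫ φ.grι i) ⊗ₘ (φ.π (j + k) ≫ φ.grι (j + k))) := by
      rw [← id_tensorHom, tensorHom_comp_tensorHom, Category.id_comp]
    rw [e1, e2, Category.assoc, Category.assoc, h1, h2,
      ← φ.t_π_grι (Nat.add_assoc i j k).le (Nat.add_assoc i j k)]
    simp only [← Category.assoc]
    have := φ.m_assoc i j k
    simp only [← Category.assoc] at this
    rw [this]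

end AlgFiltration

/-! ### Frobenius structures and perfect pairings. -/

section Pairing

variable {C : Type u} [Category.{v} C] [MonoidalCategory C]

/-! A Frobenius structure on `B` amounts to a functional `l` for which `l(xy)` is a perfect pairing,
and in an abelian rigid category it suffices that this pairing has no left or right kernel
(`IsFrobeniusAlgebra.of_nondegenerate`). So a form on gr(A) has to be carried over to `A`.

If the unit object is indecomposable, the form on gr(A) can be chosen to live in the top degree n,
and it then pulls back along A → A/F(n-1). In general the unit object may split, and each summand
has its own top degree. `exists_orthogonal_form` handles this: it finds orthogonal idempotents `p d`
of End(𝟙) and a nondegenerate form whose degree `d` part is supported on `p d`. Nondegeneracy forces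
`p d` to kill gr_i for i > d, so the degree `d` part extends from F(d) to all of `A`
(`exists_extension`). The sum of the extensions is a functional `f` on `A`.

For x in F(i) and y in F(j), the `p (i + j)` part of f(xy) is the graded form on the symbols of x
and y (`m_π_grι_form`). If x lies in a kernel of the form of `A`, its symbol therefore vanishes, so
x lies in F(i-1), and descending the filtration gives x = 0. -/

lemma bijective_whiskerRight_evaluation (X Y T : C) [ExactPairing X Y] :
    Function.Bijective fun x : T ⟶ Y => x ▷ X ≫ ε_ X Y := by
  have h : (fun x : T ⟶ Y => x ▷ X ≫ ε_ X Y) =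
      (tensorRightHomEquiv T X Y (𝟙_ C)).symm ∘ ((Iso.refl T).homCongr (λ_ Y).symm) := by
    funext x
    simp [tensorRightHomEquiv]
    monoidal
  rw [h]
  exact (Equiv.bijective _).comp (Equiv.bijective _)

lemma bijective_whiskerLeft_evaluation (X Y T : C) [ExactPairing X Y] :
    Function.Bijective fun x : T ⟶ X => Y ◁ x ≫ ε_ X Y := by
  have h : (fun x : T ⟶ X => Y ◁ x ≫ ε_ X Y) =
      (tensorLeftHomEquiv T X Y (𝟙_ C)).symm ∘ ((Iso.refl T).homCongr (ρ_ X).symm) := by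
    funext x
    simp [tensorLeftHomEquiv]
    monoidal
  rw [h]
  exact (Equiv.bijective _).comp (Equiv.bijective _)

variable {B : C} [MonObj B]

open MonObj ComonObj

/-- The counit of a Frobenius algebra defines a perfect pairing. -/
lemma IsFrobeniusAlgebra.exists_exactPairing (h : IsFrobeniusAlgebra B) :
    ∃ (l : B ⟶ 𝟙_ C) (P : ExactPairing B B), P.evaluation' = mul (X := B) ≫ l := by
  obtain ⟨_, h1, h2⟩ := h
  -- With Δ(1) as copairing, each zigzag becomes a counit law, since a Frobenius relation evaluated
  -- at 1 rewrites b·Δ(1) or Δ(1)·b as Δ(b).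
  refine ⟨counit, ⟨one ≫ comul, mul ≫ counit, ?_, ?_⟩, rfl⟩
  · have h3 : B ◁ one (X := B) ≫ B ◁ comul ≫ (α_ B B B).inv ≫ mul (X := B) ▷ B =
      (ρ_ B).hom ≫ comul := by rw [h1, mul_one_assoc]
    simp only [MonoidalCategory.whiskerLeft_comp, comp_whiskerRight, Category.assoc]
    slice_lhs 1 4 => rw [h3]
    simp
  · have h3 : one (X := B) ▷ B ≫ comul ▷ B ≫ (α_ B B B).hom ≫ B ◁ mul (X := B) =
      (λ_ B).hom ≫ comul := by rw [h2, one_mul_assoc]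
    simp only [MonoidalCategory.whiskerLeft_comp, comp_whiskerRight, Category.assoc]
    slice_lhs 1 4 => rw [h3]
    simp

/-- A perfect pairing of the form `mul ≫ l` defines a Frobenius algebra structure. -/
lemma IsFrobeniusAlgebra.of_exactPairing (l : B ⟶ 𝟙_ C) [P : ExactPairing B B]
    (hP : ε_ B B = mul (X := B) ≫ l) : IsFrobeniusAlgebra B := by
  -- Two candidates for Δ(b): multiply the copairing by b on the left, or on the right.
  let D1 : B ⟶ B ⊗ B := 𝟙 _ ⊗≫ B ◁ η_ B B ⊗≫ mul (X := B) ▷ B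
  let D2 : B ⟶ B ⊗ B := 𝟙 _ ⊗≫ η_ B B ▷ B ⊗≫ B ◁ mul (X := B)
  have ass : mul (X := B) ▷ B ≫ ε_ B B = 𝟙 _ ⊗≫ B ◁ mul (X := B) ≫ ε_ B B := by
    rw [hP, mul_assoc_assoc]; simp [monoidalComp]
  have ass2 : mul (X := B) ▷ B ≫ mul = 𝟙 _ ⊗≫ B ◁ mul (X := B) ≫ mul := by
    rw [mul_assoc]; simp [monoidalComp]
  have hD : D1 = D2 := by
    -- Transposed along the pairing, both candidates become the multiplication; for `D1` this uses
    -- that the pairing is associative.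
    apply (tensorLeftHomEquiv _ B B _).symm.injective
    have e1 : (tensorLeftHomEquiv B B B B).symm D1 = mul := by
      calc _ = 𝟙 _ ⊗≫ (B ⊗ B) ◁ η_ B B ⊗≫ (B ◁ mul (X := B) ≫ ε_ B B) ▷ B ⊗≫ 𝟙 _ := by
              simp only [tensorLeftHomEquiv, D1]; dsimp; monoidal
        _ = 𝟙 _ ⊗≫ ((B ⊗ B) ◁ η_ B B ≫ mul (X := B) ▷ (B ⊗ B)) ⊗≫ ε_ B B ▷ B ⊗≫ 𝟙 _ := by
              have : B ◁ mul (X := B) ≫ ε_ B B = 𝟙 _ ⊗≫ mul (X := B) ▷ B ≫ ε_ B B := by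
                rw [ass]; monoidal
              rw [this]; monoidal
        _ = mul (X := B) ⊗≫ (B ◁ η_ B B ⊗≫ ε_ B B ▷ B) ⊗≫ 𝟙 _ := by
              rw [whisker_exchange]; monoidal
        _ = _ := by rw [ExactPairing.coevaluation_evaluation'']; monoidal
    have e2 : (tensorLeftHomEquiv B B B B).symm D2 = mul := by
      calc _ = 𝟙 _ ⊗≫ B ◁ η_ B B ▷ B ⊗≫ ((B ⊗ B) ◁ mul (X := B) ≫ ε_ B B ▷ B) ⊗≫ 𝟙 _ := by
              simp only [tensorLeftHomEquiv, D2]; dsimp; monoidal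
        _ = 𝟙 _ ⊗≫ (B ◁ η_ B B ⊗≫ ε_ B B ▷ B) ▷ B ⊗≫ mul (X := B) := by
              rw [whisker_exchange]; monoidal
        _ = _ := by rw [ExactPairing.coevaluation_evaluation'']; monoidal
    rw [e1, e2]
  -- Each Frobenius relation is plain associativity for the candidate that multiplies on the
  -- matching side.
  have F1 : B ◁ D1 ≫ (α_ B B B).inv ≫ mul (X := B) ▷ B = mul (X := B) ≫ D1 := by
    calc _ = 𝟙 _ ⊗≫ (B ⊗ B) ◁ η_ B B ⊗≫ (𝟙 ((B ⊗ B) ⊗ B) ⊗≫ B ◁ mul (X := B) ≫ mul (X := B)) ▷ B ⊗≫ 𝟙 _ := by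
            simp only [D1]; monoidal
      _ = 𝟙 _ ⊗≫ ((B ⊗ B) ◁ η_ B B ≫ mul (X := B) ▷ (B ⊗ B)) ⊗≫ mul (X := B) ▷ B := by
            rw [← ass2]; monoidal
      _ = _ := by rw [whisker_exchange]; simp only [D1]; monoidal
  have F2 : D2 ▷ B ≫ (α_ B B B).hom ≫ B ◁ mul (X := B) = mul (X := B) ≫ D2 := by
    calc _ = 𝟙 _ ⊗≫ η_ B B ▷ (B ⊗ B) ⊗≫ B ◁ (mul (X := B) ▷ B ≫ mul (X := B)) := by
            simp only [D2]; monoidal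
      _ = 𝟙 _ ⊗≫ (η_ B B ▷ (B ⊗ B) ≫ (B ⊗ B) ◁ mul (X := B)) ⊗≫ B ◁ mul (X := B) := by
            rw [ass2]; monoidal
      _ = _ := by rw [← whisker_exchange]; simp only [D2]; monoidal
  refine ⟨{ counit := l, comul := D1, counit_comul := ?_, comul_counit := ?_, comul_assoc := ?_},
    F1, ?_⟩
  · calc _ = 𝟙 _ ⊗≫ B ◁ η_ B B ⊗≫ (mul (X := B) ≫ l) ▷ B := by simp only [D1]; monoidal
      _ = 𝟙 _ ⊗≫ (B ◁ η_ B B ⊗≫ ε_ B B ▷ B) := by rw [hP]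
      _ = _ := by rw [ExactPairing.coevaluation_evaluation'']; monoidal
  · rw [hD]
    calc _ = 𝟙 _ ⊗≫ η_ B B ▷ B ⊗≫ B ◁ (mul (X := B) ≫ l) := by simp only [D2]; monoidal
      _ = 𝟙 _ ⊗≫ (η_ B B ▷ B ⊗≫ B ◁ ε_ B B) := by rw [hP]
      _ = _ := by rw [ExactPairing.evaluation_coevaluation'']; monoidal
  -- Reading the first comultiplication as `D2` and the second as `D1`, `F1` carries the second past
  -- the product, and the interchange law finishes.
  · calc _ = D2 ≫ B ◁ D1 := by rw [hD]
      _ = 𝟙 _ ⊗≫ η_ B B ▷ B ⊗≫ B ◁ (mul (X := B) ≫ D1) := by simp only [D2]; monoidal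
      _ = 𝟙 _ ⊗≫ η_ B B ▷ B ⊗≫ B ◁ (B ◁ D2 ≫ (α_ B B B).inv ≫ mul (X := B) ▷ B) := by
            rw [← F1, ← hD]
      _ = 𝟙 _ ⊗≫ (η_ B B ▷ B ≫ (B ⊗ B) ◁ D2) ⊗≫ B ◁ mul (X := B) ▷ B ⊗≫ 𝟙 _ := by monoidal
      _ = D2 ⊗≫ D2 ▷ B ⊗≫ 𝟙 _ := by
            rw [← whisker_exchange]
            simp only [D2]
            monoidal
      _ = _ := by rw [hD]; monoidal
  · change D1 ▷ B ≫ (α_ B B B).hom ≫ B ◁ mul (X := B) = mul (X := B) ≫ D1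
    rw [hD, F2]
end Pairing

/-! ### Nondegenerate pairings in abelian rigid categories. -/

section Nondegenerate

variable {C : Type u} [Category.{v} C] [Abelian C] [MonoidalCategory C] [RigidCategory C]

/-- In an abelian rigid category, a pairing without left or right kernel is perfect. -/
lemma exists_exactPairing_of_nondegenerate {A : C} (e : A ⊗ A ⟶ 𝟙_ C)
    (hl : ∀ (T : C) (x : T ⟶ A), x ▷ A ≫ e = 0 → x = 0)
    (hr : ∀ (T : C) (x : T ⟶ A), A ◁ x ≫ e = 0 → x = 0) :
    ∃ P : ExactPairing A A, P.evaluation' = e := by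
  obtain ⟨h, hh⟩ := (bijective_whiskerRight_evaluation A Aᘁ A).2 e
  dsimp only at hh
  have h_mono : Mono h := Preadditive.mono_of_cancel_zero _ fun {T} x hx => hl T x (by
    rw [← hh, ← comp_whiskerRight_assoc, hx, ObjFiltration.zero_whisker, zero_comp])
  have h_epi : Epi h := Preadditive.epi_of_cancel_zero _ fun {Z} g hg => by
    -- Here `z` is the transpose of `g`; the equation `h ≫ g = 0` puts it in the right kernel of
    -- `e`.
    obtain ⟨z, hz⟩ := (bijective_whiskerLeft_evaluation A Aᘁ (ᘁZ)).2 (g ▷ (ᘁZ) ≫ ε_ (ᘁZ) Z)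
    dsimp only at hz
    have hz0 : z = 0 := hr _ z (by
      rw [← hh, whisker_exchange_assoc, hz, ← comp_whiskerRight_assoc, hg,
        ObjFiltration.zero_whisker, zero_comp])
    apply (bijective_whiskerRight_evaluation (ᘁZ) Z Aᘁ).1
    dsimp only
    rw [← hz, hz0, ObjFiltration.zero_whisker, ObjFiltration.whisker_zero, zero_comp, zero_comp]
  have : IsIso h := isIso_of_mono_of_epi h
  exact ⟨exactPairingCongrRight (asIso h), hh⟩

/-- An algebra with a functional without left or right kernel is Frobenius. -/
lemma IsFrobeniusAlgebra.of_nondegenerate {A : C} [MonObj A] (l : A ⟶ 𝟙_ C)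
    (hl : ∀ (T : C) (x : T ⟶ A), x ▷ A ≫ MonObj.mul (X := A) ≫ l = 0 → x = 0)
    (hr : ∀ (T : C) (x : T ⟶ A), A ◁ x ≫ MonObj.mul (X := A) ≫ l = 0 → x = 0) :
    IsFrobeniusAlgebra A := by
  obtain ⟨P, hP⟩ := exists_exactPairing_of_nondegenerate (MonObj.mul (X := A) ≫ l) hl hr
  exact IsFrobeniusAlgebra.of_exactPairing l (P := P) hP

end Nondegenerate

/-! ### Endomorphisms of the unit object. -/

section UnitAction

variable {C : Type u} [Category.{v} C] [MonoidalCategory C]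

/-- The left action of the endomorphisms of the unit object on an object. -/
def unitAct (p : 𝟙_ C ⟶ 𝟙_ C) (X : C) : X ⟶ X := (λ_ X).inv ≫ p ▷ X ≫ (λ_ X).hom

lemma unitAct_naturality (p : 𝟙_ C ⟶ 𝟙_ C) {X Y : C} (f : X ⟶ Y) :
    unitAct p X ≫ f = f ≫ unitAct p Y := by
  simp only [unitAct, Category.assoc]
  rw [← leftUnitor_naturality, ← whisker_exchange_assoc, leftUnitor_inv_naturality_assoc]

lemma unitAct_naturality_assoc (p : 𝟙_ C ⟶ 𝟙_ C) {X Y Z : C} (f : X ⟶ Y) (h : Y ⟶ Z) :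
    unitAct p X ≫ f ≫ h = f ≫ unitAct p Y ≫ h := by
  rw [reassoc_of% unitAct_naturality p f]

lemma unitAct_unit (p : 𝟙_ C ⟶ 𝟙_ C) : unitAct p (𝟙_ C) = p := by
  rw [unitAct, unitors_equal, rightUnitor_naturality, ← unitors_equal, Iso.inv_hom_id_assoc]

lemma comp_eq_unitAct_comp (p : 𝟙_ C ⟶ 𝟙_ C) {X : C} (f : X ⟶ 𝟙_ C) :
    f ≫ p = unitAct p X ≫ f := by
  rw [unitAct_naturality, unitAct_unit]

lemma unitAct_whiskerRight (p : 𝟙_ C ⟶ 𝟙_ C) (X Y : C) :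
    unitAct p X ▷ Y = unitAct p (X ⊗ Y) := by
  simp [unitAct]

/-- Naturality of the action, applied to the unit object itself. -/
lemma unit_end_comm (p q : 𝟙_ C ⟶ 𝟙_ C) : p ≫ q = q ≫ p := by
  rw [comp_eq_unitAct_comp, unitAct_unit]

end UnitAction

/-! ### Multiplication by global elements. -/

section MulBy

variable {C : Type u} [Category.{v} C] [MonoidalCategory C] {B : C} [MonObj B]

/-- Left multiplication by a global element of an algebra. -/
def leftMulBy (a : 𝟙_ C ⟶ B) : B ⟶ B := (λ_ B).inv ≫ a ▷ B ≫ MonObj.mul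

/-- Right multiplication by a global element of an algebra. -/
def rightMulBy (s : 𝟙_ C ⟶ B) : B ⟶ B := (ρ_ B).inv ≫ B ◁ s ≫ MonObj.mul

lemma leftMulBy_whiskerRight_mul (a : 𝟙_ C ⟶ B) :
    leftMulBy a ▷ B ≫ MonObj.mul = MonObj.mul ≫ leftMulBy a := by
  simp only [leftMulBy, comp_whiskerRight, Category.assoc, MonObj.mul_assoc]
  rw [leftUnitor_inv_naturality_assoc, whisker_exchange_assoc]
  simp

lemma whiskerLeft_rightMulBy_mul (s : 𝟙_ C ⟶ B) :
    B ◁ rightMulBy s ≫ MonObj.mul = MonObj.mul ≫ rightMulBy s := by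
  simp only [rightMulBy, MonoidalCategory.whiskerLeft_comp, Category.assoc]
  rw [rightUnitor_inv_naturality_assoc, ← whisker_exchange_assoc, MonObj.mul_assoc]
  simp

lemma comp_rightMulBy (a s : 𝟙_ C ⟶ B) : a ≫ rightMulBy s = s ≫ leftMulBy a := by
  simp only [rightMulBy, leftMulBy]
  rw [rightUnitor_inv_naturality_assoc, leftUnitor_inv_naturality_assoc, whisker_exchange_assoc,
    unitors_inv_equal]

lemma one_rightMulBy (s : 𝟙_ C ⟶ B) : MonObj.one ≫ rightMulBy s = s := by
  rw [comp_rightMulBy, leftMulBy, MonObj.one_mul, Iso.inv_hom_id, Category.comp_id]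

end MulBy

/-! ### Graded components and unitriangular endomorphisms. -/

namespace ObjFiltration

variable {C : Type u} [Category.{v} C] [Abelian C] {X : C} (φ : ObjFiltration X) [φ.IsFinite]

open Classical in
/-- The projection of the associated graded object onto its `i`-th component. -/
noncomputable def grPr (i : ℕ) : φ.gr ⟶ φ.grPiece i := Sigma.π φ.grPiece i

@[simp]
lemma grι_grPr (i : ℕ) : φ.grι i ≫ φ.grPr i = 𝟙 _ := by
  classical exact Sigma.ι_π_eq_id _ i

@[simp]
lemma grι_grPr_assoc (i : ℕ) {Z : C} (h : φ.grPiece i ⟶ Z) :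
    φ.grι i ≫ φ.grPr i ≫ h = h := by
  rw [reassoc_of% φ.grι_grPr i]

lemma grι_grPr_of_ne {i j : ℕ} (h : i ≠ j) : φ.grι i ≫ φ.grPr j = 0 := by
  classical exact Sigma.ι_π_of_ne _ h

lemma grι_grPr_of_ne_assoc {i j : ℕ} (h : i ≠ j) {Z : C} (f : φ.grPiece j ⟶ Z) :
    φ.grι i ≫ φ.grPr j ≫ f = 0 := by
  rw [reassoc_of% φ.grι_grPr_of_ne h, zero_comp]

variable {φ} in
lemma gr_hom_ext {Z : C} {f g : φ.gr ⟶ Z} (h : ∀ i, φ.grι i ≫ f = φ.grι i ≫ g) : f = g :=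
  Sigma.hom_ext (f := φ.grPiece) _ _ h

instance mono_grι (i : ℕ) : Mono (φ.grι i) := mono_of_mono_fac (φ.grι_grPr i)

/-- The projector of the associated graded object onto its `i`-th component. -/
noncomputable def grProj (i : ℕ) : φ.gr ⟶ φ.gr := φ.grPr i ≫ φ.grι i

@[simp]
lemma grι_grProj (i : ℕ) : φ.grι i ≫ φ.grProj i = φ.grι i := by simp [grProj]

lemma grι_grProj_of_ne {i j : ℕ} (h : i ≠ j) : φ.grι i ≫ φ.grProj j = 0 := by
  rw [grProj, grι_grPr_of_ne_assoc _ h]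

@[simp]
lemma grProj_grProj (i : ℕ) : φ.grProj i ≫ φ.grProj i = φ.grProj i := by
  simp [grProj]

lemma grProj_grProj_of_ne {i j : ℕ} (h : i ≠ j) : φ.grProj i ≫ φ.grProj j = 0 := by
  rw [grProj, Category.assoc, grι_grProj_of_ne _ h, comp_zero]

lemma exists_sum_grProj : ∃ N : ℕ, (∀ i, N ≤ i → IsZero (φ.grPiece i)) ∧
    ∑ i ∈ Finset.range N, φ.grProj i = 𝟙 _ := by
  obtain ⟨n, hn⟩ := φ.exists_isZero_grPiece
  refine ⟨n + 1, fun i hi => hn i hi, gr_hom_ext fun i => ?_⟩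
  by_cases hi : n < i
  · exact (hn i hi).eq_of_src _ _
  · rw [Preadditive.comp_sum, Finset.sum_eq_single i]
    · simp
    · exact fun j _ hj => φ.grι_grProj_of_ne hj.symm
    · simp; omega

variable {φ} in
/-- A unitriangular endomorphism of the associated graded object is invertible. -/
lemma isIso_of_unitriangular {L : φ.gr ⟶ φ.gr}
    (h0 : ∀ i j, i < j → φ.grι j ≫ L ≫ φ.grPr i = 0)
    (h1 : ∀ i, φ.grι i ≫ L ≫ φ.grPr i = 𝟙 _) : IsIso L := by
  obtain ⟨N, hN, hs⟩ := φ.exists_sum_grProj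
  have hcomp {Y Z : C} (f : Y ⟶ φ.gr) (g : φ.gr ⟶ Z) :
      f ≫ g = ∑ i ∈ Finset.range N, (f ≫ φ.grPr i) ≫ φ.grι i ≫ g := by
    conv_lhs => rw [← Category.id_comp g, ← hs]
    simp [Preadditive.comp_sum, Preadditive.sum_comp, grProj]
  have : Mono L := Preadditive.mono_of_cancel_zero _ fun {T} x hx => by
    -- Upward induction: in degree `i` of `x ≫ L`, lower components of `x` vanish already and higher
    -- ones do not contribute, as `L` never lowers degree.
    have key : ∀ i, x ≫ φ.grPr i = 0 := by
      intro i
      induction i using Nat.strong_induction_on with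
      | _ i ih =>
        by_cases hi : N ≤ i
        · exact (hN i hi).eq_of_tgt _ _
        have h2 := hcomp x (L ≫ φ.grPr i)
        rw [Finset.sum_eq_single i, h1, Category.comp_id] at h2
        · rw [← h2, reassoc_of% hx, zero_comp]
        · intro j _ hj
          rcases lt_or_gt_of_ne hj with hj | hj
          · rw [ih j hj, zero_comp]
          · rw [h0 i j hj, comp_zero]
        · simp; omega
    have h2 := hcomp x (𝟙 _)
    rw [Category.comp_id] at h2
    rw [h2]
    exact Finset.sum_eq_zero fun i _ => by rw [key i, zero_comp]
  have : Epi L := Preadditive.epi_of_cancel_zero _ fun {T} x hx => by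
    -- Downward induction from degree `N`, with `k` bounding the distance to it.
    have key : ∀ k i, N ≤ i + k → φ.grι i ≫ x = 0 := by
      intro k
      induction k with
      | zero => exact fun i hi => (hN i hi).eq_of_src _ _
      | succ k ih =>
        intro i hi
        by_cases hi' : N ≤ i
        · exact (hN i hi').eq_of_src _ _
        have h2 := hcomp (φ.grι i ≫ L) x
        rw [Finset.sum_eq_single i, Category.assoc, Category.assoc, Category.assoc,
          reassoc_of% h1] at h2
        · rw [← h2, hx, comp_zero]
        · intro j _ hj
          rcases lt_or_gt_of_ne hj with hj | hj
          · rw [Category.assoc, Category.assoc, reassoc_of% h0 j i hj, zero_comp]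
          · rw [ih j (by omega), comp_zero]
        · simp; omega
    exact gr_hom_ext fun i => by rw [key N i (by omega), comp_zero]
  exact isIso_of_mono_of_epi L

variable [MonoidalCategory C] [RigidCategory C]

variable {φ} in
lemma whiskerRight_gr_hom_ext {Y Z : C} {f g : φ.gr ⊗ Y ⟶ Z}
    (h : ∀ i, φ.grι i ▷ Y ≫ f = φ.grι i ▷ Y ≫ g) : f = g :=
  φ.hom_ext_right fun i => by
    rw [comp_whiskerRight, Category.assoc, Category.assoc, h]

variable {φ} in
lemma whiskerLeft_gr_hom_ext {Y Z : C} {f g : Y ⊗ φ.gr ⟶ Z}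
    (h : ∀ i, Y ◁ φ.grι i ≫ f = Y ◁ φ.grι i ≫ g) : f = g :=
  φ.hom_ext_left fun i => by
    rw [MonoidalCategory.whiskerLeft_comp, Category.assoc, Category.assoc, h]

end ObjFiltration

/-! ### The associated graded algebra and its orthogonal form. -/

namespace AlgFiltration

variable {C : Type u} [Category.{v} C] [MonoidalCategory C] {A : C} [MonObj A]

/-- The unit of a connected filtered algebra is an isomorphism onto the zeroth filtered piece. -/
lemma IsConnected.isIso_e {φ : AlgFiltration A} (h : φ.IsConnected) : IsIso φ.e := by
  obtain ⟨θ⟩ := h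
  -- In elements, r(x) = θ(θ⁻¹(1)·x), which sends the unit of the algebra to 1. Commutativity of
  -- End(𝟙) then makes this one-sided inverse two-sided.
  let r : φ.F.obj 0 ⟶ 𝟙_ C := (λ_ _).inv ≫ θ.inv ▷ φ.F.obj 0 ≫ φ.m 0 0 ≫ θ.hom
  have her : φ.e ≫ r = 𝟙 _ := by
    have h0 := φ.m_e 0
    simp only [r]
    rw [leftUnitor_inv_naturality_assoc, whisker_exchange_assoc]
    erw [reassoc_of% h0]
    rw [rightUnitor_naturality_assoc, ← unitors_equal]
    simp
  refine ⟨r, her, ?_⟩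
  have h1 : (φ.e ≫ θ.hom) ≫ θ.inv ≫ r = 𝟙 _ := by simpa using her
  rw [unit_end_comm] at h1
  rw [← cancel_epi θ.inv, ← cancel_mono θ.hom]
  simpa using h1

variable [Abelian C] (φ : AlgFiltration A) [φ.IsFinite]

open ObjFiltration

/-- The unit of the associated graded algebra, as a map to its zeroth component. -/
noncomputable def grUnit : 𝟙_ C ⟶ φ.grPiece 0 := φ.e ≫ φ.π 0

instance isIso_grUnit [IsIso φ.e] : IsIso φ.grUnit :=
  have : IsIso (φ.π 0) := inferInstanceAs (IsIso (𝟙 (φ.F.obj 0)))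
  inferInstanceAs (IsIso (φ.e ≫ φ.π 0))

/-- The augmentation of the associated graded algebra of a connected filtered algebra. -/
noncomputable def grAug [IsIso φ.e] : φ.gr ⟶ 𝟙_ C := φ.grPr 0 ≫ inv φ.grUnit

lemma grι_grAug_of_ne [IsIso φ.e] {i : ℕ} (h : i ≠ 0) : φ.grι i ≫ φ.grAug = 0 := by
  rw [grAug, grι_grPr_of_ne_assoc _ h]

variable [RigidCategory C]

lemma gr_one : MonObj.one (X := φ.gr) = φ.grUnit ≫ φ.grι 0 :=
  (Category.assoc _ _ _).symm

lemma grι_zero [IsIso φ.e] : φ.grι 0 = inv φ.grUnit ≫ MonObj.one (X := φ.gr) := by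
  rw [gr_one, IsIso.inv_hom_id_assoc]

lemma one_grAug [IsIso φ.e] : MonObj.one (X := φ.gr) ≫ φ.grAug = 𝟙 _ := by
  simp [gr_one, grAug]

lemma grι_zero_grAug [IsIso φ.e] : φ.grι 0 ≫ φ.grAug = inv φ.grUnit := by
  rw [grι_zero, Category.assoc, one_grAug, Category.comp_id]

lemma whisker_grι_mul (i j : ℕ) :
    φ.grι i ▷ φ.grPiece j ≫ φ.gr ◁ φ.grι j ≫ MonObj.mul (X := φ.gr) =
      φ.grMul i j ≫ φ.grι (i + j) := by
  rw [← MonoidalCategory.tensorHom_def_assoc]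
  exact φ.grι_mul i j

lemma whisker_grι_mul' (i j : ℕ) :
    φ.grPiece i ◁ φ.grι j ≫ φ.grι i ▷ φ.gr ≫ MonObj.mul (X := φ.gr) =
      φ.grMul i j ≫ φ.grι (i + j) := by
  rw [whisker_exchange_assoc, whisker_grι_mul]

lemma mul_grPr_of_lt {i j : ℕ} (h : i < j) :
    φ.gr ◁ φ.grι j ≫ MonObj.mul (X := φ.gr) ≫ φ.grPr i = 0 := by
  refine whiskerRight_gr_hom_ext fun k => ?_
  rw [reassoc_of% φ.whisker_grι_mul k j, grι_grPr_of_ne _ (by omega), comp_zero, comp_zero]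

/-- Degrees are nonnegative, so only the degree 0 part of the left factor can keep degree `j`, and
that part is a multiple of the unit. -/
lemma mul_grPr_self [IsIso φ.e] (j : ℕ) :
    φ.gr ◁ φ.grι j ≫ MonObj.mul (X := φ.gr) ≫ φ.grPr j =
      φ.grAug ▷ φ.grPiece j ≫ (λ_ _).hom := by
  refine whiskerRight_gr_hom_ext fun k => ?_
  rcases eq_or_ne k 0 with rfl | hk
  · rw [← comp_whiskerRight_assoc, grι_zero_grAug, grι_zero, comp_whiskerRight, Category.assoc,
      ← whisker_exchange_assoc, MonObj.one_mul_assoc, leftUnitor_naturality_assoc, grι_grPr,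
      Category.comp_id]
  · rw [reassoc_of% φ.whisker_grι_mul k j, grι_grPr_of_ne _ (by omega), comp_zero, ← comp_whiskerRight_assoc,
      φ.grι_grAug_of_ne hk, zero_whisker, zero_comp]

/-- Multiplicativity of the augmentation: a product has a degree 0 part only from degree 0 factors.
-/
lemma mul_grAug [IsIso φ.e] :
    MonObj.mul (X := φ.gr) ≫ φ.grAug = φ.gr ◁ φ.grAug ≫ (ρ_ _).hom ≫ φ.grAug := by
  rw [← rightUnitor_naturality, whisker_exchange_assoc, ← unitors_equal, leftUnitor_naturality]
  refine whiskerLeft_gr_hom_ext fun j => ?_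
  rw [whisker_exchange_assoc, leftUnitor_naturality_assoc]
  rcases eq_or_ne j 0 with rfl | hj
  · have h := φ.mul_grPr_self 0
    rw [φ.grι_zero_grAug, grAug, reassoc_of% h]
    rfl
  · have h := φ.mul_grPr_of_lt (Nat.pos_of_ne_zero hj)
    rw [φ.grι_grAug_of_ne hj, comp_zero, comp_zero, grAug, reassoc_of% h, zero_comp]

lemma whiskerLeft_grProj_mul (i d : ℕ) :
    φ.grPiece i ◁ φ.grProj d ≫ φ.grι i ▷ φ.gr ≫ MonObj.mul (X := φ.gr) =
      φ.grι i ▷ φ.gr ≫ MonObj.mul (X := φ.gr) ≫ φ.grProj (i + d) := by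
  refine whiskerLeft_gr_hom_ext fun j => ?_
  rw [reassoc_of% φ.whisker_grι_mul' i j, ← MonoidalCategory.whiskerLeft_comp_assoc]
  rcases eq_or_ne j d with rfl | h
  · rw [grι_grProj, grι_grProj, whisker_grι_mul']
  · rw [grι_grProj_of_ne _ h, grι_grProj_of_ne _ (by omega), whisker_zero, zero_comp, comp_zero]

lemma grι_rightMulBy_grProj (s : 𝟙_ C ⟶ φ.gr) (i d : ℕ) :
    φ.grι i ≫ rightMulBy (s ≫ φ.grProj d) = φ.grι i ≫ rightMulBy s ≫ φ.grProj (i + d) := by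
  simp only [rightMulBy, MonoidalCategory.whiskerLeft_comp, Category.assoc]
  rw [rightUnitor_inv_naturality_assoc, rightUnitor_inv_naturality_assoc,
    ← whisker_exchange_assoc, ← whisker_exchange_assoc, ← whisker_exchange_assoc,
    whiskerLeft_grProj_mul]

lemma isIso_leftMulBy [IsIso φ.e] {a : 𝟙_ C ⟶ φ.gr} (ha : a ≫ φ.grAug = 𝟙 _) :
    IsIso (leftMulBy a) := by
  have h (i j : ℕ) : φ.grι j ≫ leftMulBy a ≫ φ.grPr i = (λ_ _).inv ≫ a ▷ φ.grPiece j ≫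
      φ.gr ◁ φ.grι j ≫ MonObj.mul (X := φ.gr) ≫ φ.grPr i := by
    simp only [leftMulBy, Category.assoc]
    rw [leftUnitor_inv_naturality_assoc, whisker_exchange_assoc]
  refine isIso_of_unitriangular (fun i j hij => ?_) (fun i => ?_)
  · rw [h, φ.mul_grPr_of_lt hij, comp_zero, comp_zero]
  · rw [h, φ.mul_grPr_self, ← comp_whiskerRight_assoc, ha]
    simp

/-- The associated graded algebra of a connected filtered algebra, if Frobenius, has a
nondegenerate functional whose component in degree `d` is supported on the direct summand
`p d` of the unit object, for a family `p` of orthogonal idempotents. -/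
lemma exists_orthogonal_form [IsIso φ.e] (hgr : IsFrobeniusAlgebra φ.gr) :
    ∃ (l : φ.gr ⟶ 𝟙_ C) (p : ℕ → (𝟙_ C ⟶ 𝟙_ C)),
      (∀ d, φ.grι d ≫ l ≫ p d = φ.grι d ≫ l) ∧
      (∀ i d, i ≠ d → φ.grι i ≫ l ≫ p d = 0) ∧
      (∀ c d, c ≠ d → p c ≫ p d = 0) ∧
      (∀ (T : C) (x : T ⟶ φ.gr), x ▷ φ.gr ≫ MonObj.mul (X := φ.gr) ≫ l = 0 → x = 0) ∧
      (∀ (T : C) (x : T ⟶ φ.gr), φ.gr ◁ x ≫ MonObj.mul (X := φ.gr) ≫ l = 0 → x = 0) := by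
  obtain ⟨l, P, hP⟩ := hgr.exists_exactPairing
  replace hP : ε_ φ.gr φ.gr = MonObj.mul (X := φ.gr) ≫ l := hP
  have bl (T : C) := bijective_whiskerRight_evaluation φ.gr φ.gr T
  have br (T : C) := bijective_whiskerLeft_evaluation φ.gr φ.gr T
  simp only [hP] at bl br
  have inj_right {s t : 𝟙_ C ⟶ φ.gr} (h : rightMulBy s ≫ l = rightMulBy t ≫ l) : s = t := by
    apply (br _).1
    simpa [rightMulBy] using h
  -- `s` represents the augmentation: l(bs) = aug(b). Multiplicativity of the augmentation then
  -- gives bs = aug(b)s, so `s` plays the role of a socle generator.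
  obtain ⟨s, hs⟩ := (br (𝟙_ C)).2 ((ρ_ _).hom ≫ φ.grAug)
  dsimp only at hs
  have hs1 : rightMulBy s ≫ l = φ.grAug := by simp [rightMulBy, hs]
  have hs2 : rightMulBy s = φ.grAug ≫ s := by
    apply (br _).1
    dsimp only
    rw [reassoc_of% whiskerLeft_rightMulBy_mul s, hs1, MonoidalCategory.whiskerLeft_comp,
      Category.assoc, hs, mul_grAug]
  let p (d : ℕ) : 𝟙_ C ⟶ 𝟙_ C := s ≫ φ.grProj d ≫ l
  -- The homogeneous components of `s` inherit bs = aug(b)s, by comparing degrees.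
  have hs3 (d : ℕ) : rightMulBy (s ≫ φ.grProj d) = φ.grAug ≫ s ≫ φ.grProj d := by
    refine gr_hom_ext fun i => ?_
    rcases eq_or_ne i 0 with rfl | hi
    · rw [grι_zero, Category.assoc, Category.assoc, one_rightMulBy, reassoc_of% φ.one_grAug]
    · rw [grι_rightMulBy_grProj, hs2, Category.assoc, reassoc_of% φ.grι_grAug_of_ne hi,
        reassoc_of% φ.grι_grAug_of_ne hi, zero_comp, zero_comp]
  -- Both sides represent the functional aug(b) · `p d`. Hence `p c` acts on `s` as projection to
  -- degree `c`, which makes the `p d` orthogonal idempotents.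
  have hsp (d : ℕ) : s ≫ φ.grProj d = p d ≫ s := by
    apply inj_right
    have h : rightMulBy (p d ≫ s) ≫ l = (ρ_ _).inv ≫ φ.gr ◁ p d ≫ (ρ_ _).hom ≫ φ.grAug := by
      simp [rightMulBy, hs]
    rw [hs3, h, ← rightUnitor_naturality, whisker_exchange_assoc, ← unitors_equal,
      leftUnitor_naturality, unitors_equal, ← rightUnitor_inv_naturality_assoc,
      Iso.inv_hom_id_assoc, Category.assoc, Category.assoc]
  have hp (c d : ℕ) : p c ≫ p d = s ≫ φ.grProj c ≫ φ.grProj d ≫ l := by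
    rw [← reassoc_of% hsp c]
  have hpne (c d : ℕ) (h : c ≠ d) : p c ≫ p d = 0 := by
    rw [hp, reassoc_of% φ.grProj_grProj_of_ne h, zero_comp, comp_zero]
  have hpp (d : ℕ) : p d ≫ p d = p d := by rw [hp, reassoc_of% φ.grProj_grProj d]
  obtain ⟨N, hN, hsum⟩ := φ.exists_sum_grProj
  -- Cut the degree `d` part of `l` down to the summand `p d`.
  let l' : φ.gr ⟶ 𝟙_ C := ∑ d ∈ Finset.range N, φ.grProj d ≫ l ≫ p d
  have hl' (i : ℕ) : φ.grι i ≫ l' = φ.grι i ≫ l ≫ p i := by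
    by_cases hi : N ≤ i
    · exact (hN i hi).eq_of_src _ _
    · rw [Preadditive.comp_sum, Finset.sum_eq_single i, reassoc_of% φ.grι_grProj i]
      · exact fun j _ hj => by rw [reassoc_of% φ.grι_grProj_of_ne hj.symm, zero_comp]
      · simp; omega
  have hsl : s ≫ l = 𝟙 _ := by
    rw [← φ.one_grAug, ← hs1, reassoc_of% one_rightMulBy s]
  have hsl' : s ≫ l' = 𝟙 _ := by
    rw [← hsl, ← Category.id_comp l, ← hsum, Preadditive.sum_comp, Preadditive.comp_sum,
      Preadditive.comp_sum]
    exact Finset.sum_congr rfl fun d _ => by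
      have := hpp d
      simpa [p] using this
  -- Perfection gives l'(b) = l(ab). Moreover aug(a) = l(as) = l'(s) = 1, so left multiplication by
  -- `a` is unitriangular, hence invertible, and `l'` is nondegenerate along with `l`.
  obtain ⟨a, ha⟩ := (bl (𝟙_ C)).2 ((λ_ _).hom ≫ l')
  dsimp only at ha
  have ha1 : leftMulBy a ≫ l = l' := by simp [leftMulBy, ha]
  have : IsIso (leftMulBy a) := φ.isIso_leftMulBy (by
    rw [← hs1, reassoc_of% comp_rightMulBy a s, ha1, hsl'])
  have hml : MonObj.mul (X := φ.gr) ≫ l' =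
      leftMulBy a ▷ φ.gr ≫ MonObj.mul (X := φ.gr) ≫ l := by
    rw [← ha1, reassoc_of% leftMulBy_whiskerRight_mul a]
  refine ⟨l', p, fun d => ?_, fun i d h => ?_, hpne, fun T x hx => ?_, fun T x hx => ?_⟩
  · rw [reassoc_of% hl' d, hpp, hl']
  · rw [reassoc_of% hl' i, hpne i d h, comp_zero, comp_zero]
  · rw [hml, ← comp_whiskerRight_assoc] at hx
    rw [← cancel_mono (leftMulBy a), zero_comp]
    apply (bl _).1
    dsimp only
    rw [hx, zero_whisker, zero_comp]
  · rw [hml, whisker_exchange_assoc] at hx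
    apply (br _).1
    dsimp only
    rw [← cancel_epi (leftMulBy a ▷ T), hx, whisker_zero, zero_comp, comp_zero]

end AlgFiltration

/-! ### Extending functionals and descending along the filtration. -/

namespace ObjFiltration

variable {C : Type u} [Category.{v} C] {X : C}

lemma t_ψ (φ : ObjFiltration X) {i j : ℕ} (h : i ≤ j) :
    φ.t h ≫ φ.ψ.app j = φ.ψ.app i := by
  simp [t]

lemma exists_isIso_ψ (φ : ObjFiltration X) [φ.IsFinite] :
    ∃ n : ℕ, ∀ i, n ≤ i → IsIso (φ.ψ.app i) := by
  obtain ⟨n, hn⟩ := IsFinite.exists_stationary (φ := φ)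
  have h : φ.F.IsEventuallyConstantFrom n := fun j f => hn j (leOfHom f)
  exact ⟨n, fun i hi => h.isIso_ι_of_isColimit' φ.isColimit i (homOfLE hi)⟩

lemma IsMonic.exists_lift [Abelian C] {φ : ObjFiltration X} (hφ : φ.IsMonic) {i : ℕ} {T : C}
    (x : T ⟶ φ.F.obj (i + 1)) (hx : x ≫ φ.π (i + 1) = 0) :
    ∃ y : T ⟶ φ.F.obj i, y ≫ φ.t (Nat.le_succ i) = x := by
  have := hφ i
  exact ⟨Abelian.monoLift (φ.t (Nat.le_succ i)) x hx, Abelian.monoLift_comp _ _ _⟩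

/-- A functional on a filtered piece extends to the whole object if it is supported on a direct
summand of the unit object that acts trivially on the associated graded object in higher
degrees. -/
lemma IsMonic.exists_extension [Abelian C] [MonoidalCategory C] {φ : ObjFiltration X}
    (hφ : φ.IsMonic) [φ.IsFinite] {d : ℕ} {p : 𝟙_ C ⟶ 𝟙_ C}
    (hp : ∀ i, d < i → unitAct p (φ.grPiece i) = 0) (g : φ.F.obj d ⟶ 𝟙_ C) (hg : g ≫ p = g) :
    ∃ f : X ⟶ 𝟙_ C, φ.ψ.app d ≫ f = g ∧ f ≫ p = f := by
  have key (k : ℕ) : ∃ f : φ.F.obj (d + k) ⟶ 𝟙_ C,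
      φ.t (Nat.le_add_right d k) ≫ f = g ∧ f ≫ p = f := by
    induction k with
    | zero => exact ⟨g, by rw [t_self]; exact Category.id_comp g, hg⟩
    | succ k ih =>
      obtain ⟨f, hf, hfp⟩ := ih
      -- As `p` kills the next graded piece, its action on F(d+k+1) factors through F(d+k) by some
      -- `r`. Then `r ≫ f` extends `f`, because `p` acts trivially on `f`.
      obtain ⟨r, hr⟩ := hφ.exists_lift (unitAct p (φ.F.obj (d + k + 1))) (by
        rw [unitAct_naturality, hp _ (by omega), comp_zero])
      have := hφ (d + k)
      have htr : φ.t (Nat.le_succ (d + k)) ≫ r = unitAct p _ := by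
        rw [← cancel_mono (φ.t (Nat.le_succ (d + k))), Category.assoc, hr, unitAct_naturality]
      refine ⟨r ≫ f, ?_, by rw [Category.assoc, hfp]⟩
      rw [← φ.t_comp (Nat.le_add_right d k) (Nat.le_succ (d + k)), Category.assoc,
        reassoc_of% htr, ← comp_eq_unitAct_comp, hfp, hf]
  obtain ⟨n, hn⟩ := φ.exists_isIso_ψ
  obtain ⟨f, hf, hfp⟩ := key n
  have := hn (d + n) (by omega)
  exact ⟨inv (φ.ψ.app (d + n)) ≫ f, by rw [← φ.t_ψ (Nat.le_add_right d n)]; simpa using hf,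
    by simp [hfp]⟩

/-- Let `P` be a property of maps into the filtered object such that the symbol of any map into a
filtered piece satisfying `P` vanishes. Then only zero maps satisfy `P`. -/
lemma IsMonic.eq_zero_of_symbol_eq_zero [Abelian C] {φ : ObjFiltration X} [φ.IsFinite]
    (hφ : φ.IsMonic) {T : C} (P : (T ⟶ X) → Prop)
    (hP : ∀ (i : ℕ) (x : T ⟶ φ.F.obj i), P (x ≫ φ.ψ.app i) → x ≫ φ.π i ≫ φ.grι i = 0)
    (x : T ⟶ X) (hx : P x) : x = 0 := by
  -- A vanishing symbol lets the map descend one step; in degree 0 the symbol is the map itself.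
  have key (i : ℕ) (y : T ⟶ φ.F.obj i) (hy : P (y ≫ φ.ψ.app i)) : y = 0 := by
    have h := hP i y hy
    rw [← Category.assoc, ← zero_comp (f := φ.grι i), cancel_mono] at h
    induction i with
    | zero => exact (Category.comp_id y).symm.trans h
    | succ i ih =>
      obtain ⟨z, rfl⟩ := hφ.exists_lift y h
      have hz : P (z ≫ φ.ψ.app i) := by rwa [Category.assoc, φ.t_ψ] at hy
      have h' := hP i z hz
      rw [← Category.assoc, ← zero_comp (f := φ.grι i), cancel_mono] at h'
      rw [ih z hz h', zero_comp]
  obtain ⟨n, hn⟩ := φ.exists_isIso_ψ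
  have := hn n le_rfl
  have h := key n (x ≫ inv (φ.ψ.app n)) (by simpa using hx)
  rw [← cancel_mono (inv (φ.ψ.app n)), h, zero_comp]

end ObjFiltration

/-! ### Lifting the form from the graded to the filtered algebra. -/

namespace AlgFiltration

variable {C : Type u} [Category.{v} C] [Abelian C] [MonoidalCategory C] [RigidCategory C]
  {A : C} [MonObj A] (φ : AlgFiltration A) [φ.IsFinite]

open ObjFiltration

/-- Products with a factor in gr_i have degree at least i > d, where `l ≫ p` vanishes; so the image
of gr_i under `p` lies in the left kernel of the form. -/
lemma unitAct_grPiece_eq_zero {l : φ.gr ⟶ 𝟙_ C} {p : 𝟙_ C ⟶ 𝟙_ C} {d : ℕ}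
    (hp : ∀ i, i ≠ d → φ.grι i ≫ l ≫ p = 0)
    (hl : ∀ (T : C) (x : T ⟶ φ.gr), x ▷ φ.gr ≫ MonObj.mul (X := φ.gr) ≫ l = 0 → x = 0)
    (i : ℕ) (hi : d < i) : unitAct p (φ.grPiece i) = 0 := by
  rw [← cancel_mono (φ.grι i), zero_comp]
  refine hl _ _ (whiskerLeft_gr_hom_ext fun j => ?_)
  rw [comp_whiskerRight_assoc, unitAct_whiskerRight, ← unitAct_naturality_assoc,
    reassoc_of% φ.whisker_grι_mul' i j, unitAct_naturality_assoc, unitAct_naturality_assoc,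
    ← comp_eq_unitAct_comp, hp _ (by omega), comp_zero, comp_zero]

/-- A nondegenerate functional on the associated graded algebra, with component in degree `d`
supported on the summand `p d` of the unit object, lifts to the filtered algebra. -/
lemma exists_lift_form (hφ : φ.IsMonic) {l : φ.gr ⟶ 𝟙_ C} {p : ℕ → (𝟙_ C ⟶ 𝟙_ C)}
    (h1 : ∀ d, φ.grι d ≫ l ≫ p d = φ.grι d ≫ l)
    (h2 : ∀ i d, i ≠ d → φ.grι i ≫ l ≫ p d = 0)
    (h3 : ∀ c d, c ≠ d → p c ≫ p d = 0)
    (hl : ∀ (T : C) (x : T ⟶ φ.gr), x ▷ φ.gr ≫ MonObj.mul (X := φ.gr) ≫ l = 0 → x = 0) :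
    ∃ f : A ⟶ 𝟙_ C, ∀ d, φ.ψ.app d ≫ f ≫ p d = φ.π d ≫ φ.grι d ≫ l := by
  choose f hf hfp using fun d => hφ.exists_extension
    (φ.unitAct_grPiece_eq_zero (fun i => h2 i d) hl) (φ.π d ≫ φ.grι d ≫ l) (by simp [h1])
  obtain ⟨N, hN⟩ := φ.exists_isZero_grPiece
  -- Postcomposing with `p d` isolates the summand `f d`, by orthogonality; for d > N both sides
  -- vanish.
  refine ⟨∑ d ∈ Finset.range (N + 1), f d, fun d => ?_⟩
  have hne (c : ℕ) (hc : c ≠ d) : f c ≫ p d = 0 := by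
    rw [← hfp c, Category.assoc, h3 c d hc, comp_zero]
  rw [Preadditive.sum_comp]
  by_cases hd : d < N + 1
  · rw [Finset.sum_eq_single d (fun c _ hc => hne c hc) (by simp; omega), hfp, hf]
  · rw [Finset.sum_eq_zero fun c hc => hne c (by simp at hc; omega),
      (hN d (by omega)).eq_of_src (φ.grι d) 0, zero_comp, comp_zero, comp_zero]

variable {φ} in
-- Compares the forms: the graded one sees only the top symbol of a product, which `f` reproduces
-- after projecting to the summand `p (i + j)`.
lemma m_π_grι_form {f : A ⟶ 𝟙_ C} {l : φ.gr ⟶ 𝟙_ C} {p : ℕ → (𝟙_ C ⟶ 𝟙_ C)}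
    (hf : ∀ d, φ.ψ.app d ≫ f ≫ p d = φ.π d ≫ φ.grι d ≫ l) (i j : ℕ) :
    ((φ.π i ≫ φ.grι i) ⊗ₘ (φ.π j ≫ φ.grι j)) ≫ MonObj.mul (X := φ.gr) ≫ l =
      (φ.ψ.app i ⊗ₘ φ.ψ.app j) ≫ MonObj.mul (X := A) ≫ f ≫ p (i + j) := by
  have h := φ.π_grι_mul i j
  have h' := φ.m_ψ i j
  rw [← reassoc_of% h', hf]
  erw [reassoc_of% h]

end AlgFiltration

theorem theorem5p3 {C : Type u} [Category.{v} C] [Abelian C] [MonoidalCategory C]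
    [RigidCategory C] (A : C) [MonObj A] (φ : AlgFiltration A) [φ.IsFinite]
    (hmonic : φ.IsMonic) (hconn : φ.IsConnected) (hgr : IsFrobeniusAlgebra φ.gr) :
    IsFrobeniusAlgebra A := by
  have := hconn.isIso_e
  obtain ⟨l, p, h1, h2, h3, hl, hr⟩ := φ.exists_orthogonal_form hgr
  obtain ⟨f, hf⟩ := φ.exists_lift_form hmonic h1 h2 h3 hl
  refine IsFrobeniusAlgebra.of_nondegenerate f (fun T => ?_) (fun T => ?_)
  -- For x in the left kernel, pairing its symbol with any symbol from F(j) gives a `p (i + j)` part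
  -- of f(xy) = 0; these symbols jointly cover gr(A), so graded nondegeneracy applies.
  · refine hmonic.eq_zero_of_symbol_eq_zero _ fun i x hx =>
      hl _ _ (φ.hom_ext_left fun j => ?_)
    have h := AlgFiltration.m_π_grι_form hf i j
    rw [MonoidalCategory.tensorHom_def, MonoidalCategory.tensorHom_def, Category.assoc,
      Category.assoc] at h
    dsimp only [Functor.const_obj_obj] at h
    rw [comp_whiskerRight, Category.assoc] at hx
    rw [comp_whiskerRight, Category.assoc, whisker_exchange_assoc, whisker_exchange_assoc, h]
    rw [← whisker_exchange_assoc, ← whisker_exchange_assoc, reassoc_of% hx, zero_comp, comp_zero,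
      comp_zero]
  · refine hmonic.eq_zero_of_symbol_eq_zero _ fun i x hx =>
      hr _ _ (φ.hom_ext_right fun j => ?_)
    have h := AlgFiltration.m_π_grι_form hf j i
    rw [MonoidalCategory.tensorHom_def', MonoidalCategory.tensorHom_def', Category.assoc,
      Category.assoc] at h
    dsimp only [Functor.const_obj_obj] at h
    rw [MonoidalCategory.whiskerLeft_comp, Category.assoc] at hx
    rw [MonoidalCategory.whiskerLeft_comp, Category.assoc, ← whisker_exchange_assoc,
      ← whisker_exchange_assoc, h, whisker_exchange_assoc, whisker_exchange_assoc,
      reassoc_of% hx, zero_comp, comp_zero, comp_zero]
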